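/- Let $d\ge 1$, let $\mathcal C\subset\mathbb R^d$ be compact and regular: there are $c,r_0>0$ with $\mathrm{Leb}(\mathcal C\cap B(x,r))\ge c\,\mathrm{Leb}(B(x,r))$ for all $x\in\mathcal C$ and $0<r\le r_0$, where $B(x,r)$ is the closed Euclidean ball. Let $f^*$ be a real function that is Lipschitz on $\mathcal C$, and let $c_0>0$, $\mu_{\min}>0$, $p\ge 1$ and $0<a\le b$. Then there is a constant $C>0$, depending only on $d,\mathcal C,f^*,c_0,\mu_{\min},p,a,b$, such that the following holds. Let $(X,Y)$ be a random pair in $\mathbb R^d\times\mathbb R$ with $Y$ integrable such that - (strong density) $X\in\mathcal C$ almost surely, and the law of $X$ has a Lebesgue density $\mu$ with $\mu_{\min}\le\mu(x)\le\mu_{\max}$ for all $x\in\mathcal C$, for some $\mu_{\max}<\infty$; - (regression function) $\mathbb E[Y\mid X]=f^*(X)$ almost surely; - (uniform noise condition) $\mathbb E[\exp(\lambda(Y-f^*(X)))\mid X]\le\exp(c_0^2\lambda^2)$ almost surely, for every real $\lambda$ with $|\lambda|\le 1/c_0$. Let $n\ge 2$, let $(X_1,Y_1),\dots,(X_n,Y_n)$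 be independent copies of $(X,Y)$, and let $k_n\le n$ be an integer with $a\,n^{2/(d+2)}\le k_n\le b\,n^{2/(d+2)}$. For $x\in\mathbb R^d$ let $(X_{(1,n)}(x),Y_{(1,n)}(x)),\dots,(X_{(n,n)}(x),Y_{(n,n)}(x))$ be the sample reordered by increasing Euclidean distance $\|X_i-x\|$, ties being broken in favour of the smaller index, and let $\hat f(x)=\frac1{k_n}\sum_{i=1}^{k_n}Y_{(i,n)}(x)$. Then $\sup_{x\in\mathcal C}|\hat f(x)-f^*(x)|$ is measurable (up to a null set) and $$\mathbb E\Big[\Big(\sup_{x\in\mathcal C}|\hat f(x)-f^*(x)|\Big)^p\Big]\le C\,\log(n)^p\,n^{-p/(d+2)}.$$ -/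

import Mathlib

open MeasureTheory ProbabilityTheory
open scoped ENNReal

/-- A regular set in the sense of Audibert and Tsybakov: for some `c, r₀ > 0`, every closed ball
`B(x, r)` with `x ∈ K` and `0 < r ≤ r₀` satisfies `Leb (K ∩ B(x, r)) ≥ c · Leb (B(x, r))`. -/
def IsRegularSet {d : ℕ} (K : Set (EuclideanSpace ℝ (Fin d))) : Prop :=
  MeasurableSet K ∧ ∃ c r₀ : ℝ, 0 < c ∧ 0 < r₀ ∧
    ∀ x ∈ K, ∀ r : ℝ, 0 < r → r ≤ r₀ →
      ENNReal.ofReal c * volume (Metric.closedBall x r) ≤ volume (K ∩ Metric.closedBall x r)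

/-- Strong density assumption: the marginal law `Q` of `X` is carried by `K` and has a Lebesgue
density `μ` with `μmin ≤ μ ≤ μmax` on `K`. -/
def StrongDensity {d : ℕ} (Q : Measure (EuclideanSpace ℝ (Fin d)))
    (K : Set (EuclideanSpace ℝ (Fin d))) (μmin μmax : ℝ) : Prop :=
  (∀ᵐ x ∂Q, x ∈ K) ∧
    ∃ μ : EuclideanSpace ℝ (Fin d) → ℝ, Measurable μ ∧
      Q = volume.withDensity (fun x => ENNReal.ofReal (μ x)) ∧
      ∀ x ∈ K, μmin ≤ μ x ∧ μ x ≤ μmax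

/-- The sigma-algebra generated by the feature `X` on the space of pairs `(X, Y)`. -/
abbrev featureSigma (d : ℕ) : MeasurableSpace (EuclideanSpace ℝ (Fin d) × ℝ) :=
  MeasurableSpace.comap Prod.fst inferInstance

/-- `f` is (a version of) the regression function of the law `P` of `(X, Y)`:
`f(X) = E[Y | X]` almost surely. -/
def IsRegressionFunction {d : ℕ} (P : Measure (EuclideanSpace ℝ (Fin d) × ℝ))
    (f : EuclideanSpace ℝ (Fin d) → ℝ) : Prop :=
  Integrable (fun z : EuclideanSpace ℝ (Fin d) × ℝ => z.2) P ∧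
    P[fun z : EuclideanSpace ℝ (Fin d) × ℝ => z.2 | featureSigma d] =ᵐ[P] fun z => f z.1

/-- Uniform noise condition: `E[exp (t (Y - f(X))) | X] ≤ exp (c₀² t²)` almost surely,
for all `|t| ≤ 1 / c₀`. -/
def UniformNoise {d : ℕ} (P : Measure (EuclideanSpace ℝ (Fin d) × ℝ))
    (f : EuclideanSpace ℝ (Fin d) → ℝ) (c₀ : ℝ) : Prop :=
  ∀ t : ℝ, |t| ≤ 1 / c₀ →
    Integrable (fun z : EuclideanSpace ℝ (Fin d) × ℝ => Real.exp (t * (z.2 - f z.1))) P ∧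
    P[fun z : EuclideanSpace ℝ (Fin d) × ℝ => Real.exp (t * (z.2 - f z.1)) | featureSigma d]
      ≤ᵐ[P] fun _ => Real.exp (c₀ ^ 2 * t ^ 2)

/-- The permutation that orders the sample points by increasing Euclidean distance to `x`.
`Tuple.sort` breaks ties in favour of the smaller index. -/
noncomputable def nnOrder {d n : ℕ} (X : Fin n → EuclideanSpace ℝ (Fin d))
    (x : EuclideanSpace ℝ (Fin d)) : Equiv.Perm (Fin n) :=
  Tuple.sort (fun i => ‖X i - x‖)

/-- The `k`-nearest-neighbour regression estimator at `x`: the mean of the responses attached to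
the first `k` sample points in the order `nnOrder X x`. -/
noncomputable def knnEstimator {d n : ℕ} (k : ℕ) (X : Fin n → EuclideanSpace ℝ (Fin d))
    (Y : Fin n → ℝ) (x : EuclideanSpace ℝ (Fin d)) : ℝ :=
  (1 / (k : ℝ)) * ∑ i ∈ Finset.univ.filter (fun i : Fin n => (i : ℕ) < k), Y (nnOrder X x i)

/-- The error in sup norm over `K` of the `k`-nearest-neighbour estimator, as an extended
nonnegative number. -/
noncomputable def knnSupError {d n : ℕ} (K : Set (EuclideanSpace ℝ (Fin d)))
    (f : EuclideanSpace ℝ (Fin d) → ℝ) (k : ℕ) (X : Fin n → EuclideanSpace ℝ (Fin d))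
    (Y : Fin n → ℝ) : ℝ≥0∞ :=
  ⨆ x ∈ K, ENNReal.ofReal |knnEstimator k X Y x - f x|

/-- The indices of the first `k` sample points in the order `nnOrder X x`. -/
noncomputable def nnSet {d n : ℕ} (k : ℕ) (X : Fin n → EuclideanSpace ℝ (Fin d))
    (x : EuclideanSpace ℝ (Fin d)) : Finset (Fin n) :=
  (Finset.univ.filter (fun i : Fin n => (i : ℕ) < k)).map (nnOrder X x).toEmbedding

theorem mem_nnSet {d n k : ℕ} {X : Fin n → EuclideanSpace ℝ (Fin d)}
    {x : EuclideanSpace ℝ (Fin d)} {i : Fin n} :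
    i ∈ nnSet k X x ↔ ((nnOrder X x).symm i : ℕ) < k := by
  simp only [nnSet, Finset.mem_map_equiv, Finset.mem_filter, Finset.mem_univ, true_and]

theorem card_nnSet {d n k : ℕ} (hk : k ≤ n) (X : Fin n → EuclideanSpace ℝ (Fin d))
    (x : EuclideanSpace ℝ (Fin d)) : (nnSet k X x).card = k := by
  rw [nnSet, Finset.card_map, Fin.card_filter_val_lt, min_eq_right hk]

theorem knnEstimator_eq_sum_nnSet {d n : ℕ} (k : ℕ) (X : Fin n → EuclideanSpace ℝ (Fin d))
    (Y : Fin n → ℝ) (x : EuclideanSpace ℝ (Fin d)) :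
    knnEstimator k X Y x = (1 / (k : ℝ)) * ∑ i ∈ nnSet k X x, Y i := by
  simp [knnEstimator, nnSet]

/-- Members of `nnSet k X x` precede nonmembers, in the order by distance and then by index. -/
theorem dist_lt_or_eq_of_mem_nnSet {d n k : ℕ} {X : Fin n → EuclideanSpace ℝ (Fin d)}
    {x : EuclideanSpace ℝ (Fin d)} {i j : Fin n} (hi : i ∈ nnSet k X x) (hj : j ∉ nnSet k X x) :
    ‖X i - x‖ < ‖X j - x‖ ∨ ‖X i - x‖ = ‖X j - x‖ ∧ i < j := by
  rw [mem_nnSet] at hi hj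
  have hlt : (nnOrder X x).symm i < (nnOrder X x).symm j := by
    rw [Fin.lt_def]; omega
  have h := (Tuple.eq_sort_iff (f := fun i => ‖X i - x‖) (σ := nnOrder X x)).1 rfl
  have h1 := h.1 hlt.le
  simp only [Function.comp, Equiv.apply_symm_apply] at h1
  rcases h1.lt_or_eq with h2 | h2
  · exact Or.inl h2
  · refine Or.inr ⟨h2, ?_⟩
    simpa using h.2 _ _ hlt (by simpa using h2)

/-- The sets of `k` nearest neighbours of the points of `K`. -/
noncomputable def nnFamily {d n : ℕ} (K : Set (EuclideanSpace ℝ (Fin d))) (k : ℕ)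
    (X : Fin n → EuclideanSpace ℝ (Fin d)) : Finset (Finset (Fin n)) :=
  open Classical in Finset.univ.filter fun S => ∃ x ∈ K, nnSet k X x = S

theorem mem_nnFamily {d n k : ℕ} {K : Set (EuclideanSpace ℝ (Fin d))}
    {X : Fin n → EuclideanSpace ℝ (Fin d)} {S : Finset (Fin n)} :
    S ∈ nnFamily K k X ↔ ∃ x ∈ K, nnSet k X x = S := by
  simp [nnFamily]

theorem card_le_of_shatters_nnFamily {d n k : ℕ} {K : Set (EuclideanSpace ℝ (Fin d))}
    {X : Fin n → EuclideanSpace ℝ (Fin d)} {T : Finset (Fin n)}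
    (hT : (nnFamily K k X).Shatters T) : T.card ≤ d + 3 := by
  by_contra! hcard
  let φ : T → EuclideanSpace ℝ (Fin d) × ℝ × ℝ × ℝ := fun i => (X i, ‖X i‖ ^ 2, ((i : ℕ) : ℝ), 1)
  have hdep : ¬ LinearIndependent ℝ φ := by
    intro h
    have := h.fintype_card_le_finrank
    simp at this
    omega
  obtain ⟨c, hc, i₀, hi₀⟩ := Fintype.not_linearIndependent_iff.1 hdep
  have hX : ∑ i, c i • X i = 0 := by simpa [φ, Prod.fst_sum] using congrArg Prod.fst hc
  have hsq : ∑ i, c i * ‖X i‖ ^ 2 = 0 := by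
    simpa [φ, Prod.fst_sum, Prod.snd_sum] using congrArg (fun z => z.2.1) hc
  have hidx : ∑ i : T, c i * ((i : ℕ) : ℝ) = 0 := by
    simpa [φ, Prod.fst_sum, Prod.snd_sum] using congrArg (fun z => z.2.2.1) hc
  have hone : ∑ i, c i = 0 := by
    simpa [φ, Prod.fst_sum, Prod.snd_sum] using congrArg (fun z => z.2.2.2) hc
  obtain ⟨i₁, -, hi₁⟩ := Finset.exists_pos_of_sum_zero_of_exists_nonzero c hone
    ⟨i₀, Finset.mem_univ _, hi₀⟩
  obtain ⟨i₂, -, hi₂⟩ := Finset.exists_pos_of_sum_zero_of_exists_nonzero (fun i => - c i)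
    (by simpa using hone) ⟨i₀, Finset.mem_univ _, by simpa using hi₀⟩
  obtain ⟨S, hS, hTS⟩ := hT (t := (Finset.univ.filter fun i : T => 0 < c i).map
    (Function.Embedding.subtype _)) (by
      intro i hi
      simp only [Finset.mem_map] at hi
      obtain ⟨j, -, rfl⟩ := hi
      exact j.2)
  obtain ⟨x, -, rfl⟩ := mem_nnFamily.1 hS
  have hmem : ∀ i : T, (i : Fin n) ∈ nnSet k X x ↔ 0 < c i := by
    intro i
    have := Finset.ext_iff.1 hTS i
    simpa using this
  set q : Fin n → ℝ := fun i => ‖X i - x‖ ^ 2 with hq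
  have hqsum : ∑ i, c i * q i = 0 := by
    have h1 : ∀ i : T, c i * q i =
        c i * ‖X i‖ ^ 2 - 2 * inner ℝ (c i • X i) x + c i * ‖x‖ ^ 2 := by
      intro i
      rw [hq]
      simp only [norm_sub_sq_real, inner_smul_left, conj_trivial]
      ring
    rw [Finset.sum_congr rfl fun i _ => h1 i, Finset.sum_add_distrib, Finset.sum_sub_distrib,
      ← Finset.mul_sum, ← sum_inner, hX, ← Finset.sum_mul, hone, hsq]
    simp
  have hlex : ∀ i j : T, 0 < c i → ¬ 0 < c j → q i < q j ∨ q i = q j ∧ i < j := by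
    intro i j hi hj
    rcases dist_lt_or_eq_of_mem_nnSet ((hmem i).2 hi) (fun h => hj ((hmem j).1 h)) with h | ⟨h, h'⟩
    · exact Or.inl (pow_lt_pow_left₀ h (norm_nonneg _) two_ne_zero)
    · exact Or.inr ⟨by simp [hq, h], h'⟩
  obtain ⟨m, hm, hmax⟩ := (Finset.univ.filter fun i : T => 0 < c i).exists_max_image
    (fun i => toLex (q i, i)) ⟨i₁, by simpa using hi₁⟩
  simp only [Finset.mem_filter, Finset.mem_univ, true_and, Prod.Lex.toLex_le_toLex] at hm hmax
  have h1 : ∀ i : T, c i * (q i - q m) ≤ 0 := by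
    intro i
    by_cases hi : 0 < c i
    · rcases hmax i hi with h | h
      · exact mul_nonpos_of_nonneg_of_nonpos hi.le (by linarith)
      · rw [h.1]; simp
    · have : q m ≤ q i := by
        rcases hlex m i hm hi with h | h
        · exact h.le
        · exact h.1.le
      exact mul_nonpos_of_nonpos_of_nonneg (not_lt.1 hi) (by linarith)
  have h2 : ∀ i : T, c i * (q i - q m) = 0 := by
    have hs : ∑ i : T, c i * (q i - q m) = 0 := by
      simp only [mul_sub, Finset.sum_sub_distrib, ← Finset.sum_mul, hqsum, hone, zero_mul, sub_zero]
    intro i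
    exact (Finset.sum_eq_zero_iff_of_nonpos fun i _ => h1 i).1 hs i (Finset.mem_univ _)
  have h3 : ∀ i : T, c i ≠ 0 → q i = q m := by
    intro i hi
    have := (mul_eq_zero.1 (h2 i)).resolve_left hi
    linarith
  have hcast : ∀ i j : T, i ≤ j → (((i : Fin n) : ℕ) : ℝ) ≤ (((j : Fin n) : ℕ) : ℝ) := by
    intro i j hij
    exact_mod_cast hij
  have h4 : ∀ i : T, c i * (((i : ℕ) : ℝ) - ((m : ℕ) : ℝ)) ≤ 0 := by
    intro i
    rcases lt_trichotomy (c i) 0 with hi | hi | hi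
    · have : m < i := by
        rcases hlex m i hm hi.not_gt with h | h
        · exact absurd (h3 i hi.ne) h.ne'
        · exact h.2
      exact mul_nonpos_of_nonpos_of_nonneg hi.le (sub_nonneg.2 (hcast _ _ this.le))
    · simp [hi]
    · have : i ≤ m := by
        rcases hmax i hi with h | h
        · exact absurd (h3 i hi.ne') h.ne
        · exact h.2
      exact mul_nonpos_of_nonneg_of_nonpos hi.le (sub_nonpos.2 (hcast _ _ this))
  have hs : ∑ i : T, c i * (((i : ℕ) : ℝ) - ((m : ℕ) : ℝ)) = 0 := by
    simp only [mul_sub, Finset.sum_sub_distrib, ← Finset.sum_mul, hidx, hone, zero_mul, sub_zero]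
  have h5 := (Finset.sum_eq_zero_iff_of_nonpos fun i _ => h4 i).1 hs i₂ (Finset.mem_univ _)
  have hneg : c i₂ < 0 := by simpa using hi₂
  have h6 := (mul_eq_zero.1 h5).resolve_left hneg.ne
  have h7 : m < i₂ := by
    rcases hlex m i₂ hm hneg.not_gt with h | h
    · exact absurd (h3 i₂ hneg.ne) h.ne'
    · exact h.2
  have h8 : (((m : Fin n) : ℕ) : ℝ) < (((i₂ : Fin n) : ℕ) : ℝ) := by exact_mod_cast h7
  linarith

theorem sum_choose_le_succ_pow (n D : ℕ) :
    ∑ j ∈ Finset.Iic D, n.choose j ≤ (n + 1) ^ D := by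
  rw [add_pow, ← Nat.range_succ_eq_Iic]
  refine Finset.sum_le_sum fun j hj => ?_
  have h1 : 1 ≤ D.choose j := Nat.choose_pos (by simp at hj; omega)
  calc n.choose j ≤ n ^ j := Nat.choose_le_pow n j
    _ ≤ n ^ j * 1 ^ (D - j) * D.choose j := by
      rw [one_pow, mul_one]; exact Nat.le_mul_of_pos_right _ h1

/-- The points of `K` have only polynomially many sets of `k` nearest neighbours. -/
theorem card_nnFamily_le {d n k : ℕ} (K : Set (EuclideanSpace ℝ (Fin d)))
    (X : Fin n → EuclideanSpace ℝ (Fin d)) :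
    (nnFamily K k X).card ≤ (n + 1) ^ (d + 3) := by
  have h1 : (nnFamily K k X).vcDim ≤ d + 3 :=
    Finset.sup_le fun T hT => card_le_of_shatters_nnFamily (Finset.mem_shatterer.1 hT)
  calc (nnFamily K k X).card ≤ (nnFamily K k X).shatterer.card :=
        Finset.card_le_card_shatterer _
    _ ≤ ∑ j ∈ Finset.Iic (nnFamily K k X).vcDim, (Fintype.card (Fin n)).choose j :=
        Finset.card_shatterer_le_sum_vcDim
    _ ≤ ∑ j ∈ Finset.Iic (d + 3), n.choose j := by
        rw [Fintype.card_fin]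
        exact Finset.sum_le_sum_of_subset (Finset.Iic_subset_Iic.2 h1)
    _ ≤ (n + 1) ^ (d + 3) := sum_choose_le_succ_pow n _

/-- An ordering is the nearest-neighbour ordering iff one of countably many closed conditions
holds. -/
theorem nnOrder_eq_iff {d n : ℕ} {X : Fin n → EuclideanSpace ℝ (Fin d)}
    {x : EuclideanSpace ℝ (Fin d)} {σ : Equiv.Perm (Fin n)} :
    nnOrder X x = σ ↔ ∃ m : ℕ, ∀ i j, i < j →
      ‖X (σ i) - x‖ + (if σ j < σ i then 1 / ((m : ℝ) + 1) else 0) ≤ ‖X (σ j) - x‖ := by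
  have h := Tuple.eq_sort_iff (f := fun i => ‖X i - x‖) (σ := σ)
  rw [nnOrder, eq_comm, h]
  constructor
  · rintro ⟨hmono, hties⟩
    have key : ∀ i j, ∀ᶠ m : ℕ in Filter.atTop, i < j →
        ‖X (σ i) - x‖ + (if σ j < σ i then 1 / ((m : ℝ) + 1) else 0) ≤ ‖X (σ j) - x‖ := by
      intro i j
      by_cases hij : i < j
      · have h1 : ‖X (σ i) - x‖ ≤ ‖X (σ j) - x‖ := hmono hij.le
        by_cases hσ : σ j < σ i
        · have h2 : ‖X (σ i) - x‖ < ‖X (σ j) - x‖ :=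
            h1.lt_of_ne fun he => (hties i j hij he).not_gt hσ
          filter_upwards [(tendsto_one_div_add_atTop_nhds_zero_nat (𝕜 := ℝ)).eventually
            (gt_mem_nhds (sub_pos.2 h2))] with m hm _
          rw [if_pos hσ]
          linarith
        · simp [hσ, h1]
      · simp [hij]
    obtain ⟨m, hm⟩ := (Filter.eventually_all.2 fun i => Filter.eventually_all.2 (key i)).exists
    exact ⟨m, hm⟩
  · rintro ⟨m, hm⟩
    have hpos : (0 : ℝ) < 1 / ((m : ℝ) + 1) := by positivity
    constructor
    · refine monotone_iff_forall_lt.2 fun i j hij => ?_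
      have := hm i j hij
      simp only [Function.comp]
      split_ifs at this <;> linarith
    · intro i j hij he
      have h1 := hm i j hij
      by_contra hc
      have hne : σ i ≠ σ j := fun h => hij.ne (σ.injective h)
      rw [if_pos (lt_of_le_of_ne (not_lt.1 hc) hne.symm)] at h1
      linarith

theorem measurableSet_exists_nnOrder {d n : ℕ} {K : Set (EuclideanSpace ℝ (Fin d))}
    (hK : IsCompact K) (σ : Equiv.Perm (Fin n))
    (G : (Fin n → EuclideanSpace ℝ (Fin d) × ℝ) → EuclideanSpace ℝ (Fin d) → ℝ)
    (hG : Continuous fun q : (Fin n → EuclideanSpace ℝ (Fin d) × ℝ) × K => G q.1 q.2) (t : ℝ) :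
    MeasurableSet {w : Fin n → EuclideanSpace ℝ (Fin d) × ℝ |
      ∃ x ∈ K, nnOrder (fun i => (w i).1) x = σ ∧ t < G w x} := by
  have : CompactSpace K := isCompact_iff_compactSpace.1 hK
  let A : ℕ → ℕ → Set ((Fin n → EuclideanSpace ℝ (Fin d) × ℝ) × K) := fun m l =>
    {q | (∀ i j, i < j → ‖(q.1 (σ i)).1 - q.2‖ + (if σ j < σ i then 1 / ((m : ℝ) + 1) else 0)
      ≤ ‖(q.1 (σ j)).1 - q.2‖) ∧ t + 1 / ((l : ℝ) + 1) ≤ G q.1 q.2}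
  have hA : ∀ m l, IsClosed (A m l) := by
    intro m l
    have heq : A m l = (⋂ i, ⋂ j, ⋂ _ : i < j,
        {q : (Fin n → EuclideanSpace ℝ (Fin d) × ℝ) × K | ‖(q.1 (σ i)).1 - q.2‖ + (if σ j < σ i then 1 / ((m : ℝ) + 1) else 0)
          ≤ ‖(q.1 (σ j)).1 - q.2‖}) ∩ {q | t + 1 / ((l : ℝ) + 1) ≤ G q.1 q.2} := by
      ext q
      simp only [A, Set.mem_inter_iff, Set.mem_iInter, Set.mem_ofPred_eq]
    rw [heq]
    refine IsClosed.inter ?_ (isClosed_le continuous_const hG)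
    refine isClosed_iInter fun i => isClosed_iInter fun j => isClosed_iInter fun _ => ?_
    exact isClosed_le (by fun_prop) (by fun_prop)
  have heq : {w : Fin n → EuclideanSpace ℝ (Fin d) × ℝ |
      ∃ x ∈ K, nnOrder (fun i => (w i).1) x = σ ∧ t < G w x} =
      ⋃ m, ⋃ l, Prod.fst '' A m l := by
    ext w
    simp only [Set.mem_ofPred_eq, Set.mem_iUnion, Set.mem_image]
    constructor
    · rintro ⟨x, hx, hσ, ht⟩
      obtain ⟨m, hm⟩ := nnOrder_eq_iff.1 hσ
      obtain ⟨l, hl⟩ := exists_nat_one_div_lt (sub_pos.2 ht)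
      exact ⟨m, l, (w, ⟨x, hx⟩), ⟨hm, by simp only at hl ⊢; linarith⟩, rfl⟩
    · rintro ⟨m, l, ⟨w', x⟩, ⟨hm, hl⟩, rfl⟩
      have hpos : (0 : ℝ) < 1 / ((l : ℝ) + 1) := by positivity
      exact ⟨x, x.2, nnOrder_eq_iff.2 ⟨m, hm⟩, by simp only at hl ⊢; linarith⟩
  rw [heq]
  exact MeasurableSet.iUnion fun m => MeasurableSet.iUnion fun l =>
    (isClosedMap_fst_of_compactSpace _ (hA m l)).measurableSet

theorem measurableSet_mem_nnFamily {d n : ℕ} {K : Set (EuclideanSpace ℝ (Fin d))}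
    (hK : IsCompact K) (k : ℕ) (S : Finset (Fin n)) :
    MeasurableSet {w : Fin n → EuclideanSpace ℝ (Fin d) × ℝ |
      S ∈ nnFamily K k fun i => (w i).1} := by
  have heq : {w : Fin n → EuclideanSpace ℝ (Fin d) × ℝ | S ∈ nnFamily K k fun i => (w i).1} =
      ⋃ σ : Equiv.Perm (Fin n),
        ⋃ _ : (Finset.univ.filter (fun i : Fin n => (i : ℕ) < k)).map σ.toEmbedding = S,
        {w | ∃ x ∈ K, nnOrder (fun i => (w i).1) x = σ ∧ (0 : ℝ) < 1} := by
    ext w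
    simp only [Set.mem_ofPred_eq, mem_nnFamily, Set.mem_iUnion, exists_prop]
    constructor
    · rintro ⟨x, hx, rfl⟩
      exact ⟨_, rfl, x, hx, rfl, one_pos⟩
    · rintro ⟨σ, hS, x, hx, rfl, -⟩
      exact ⟨x, hx, hS⟩
  rw [heq]
  exact MeasurableSet.iUnion fun σ => MeasurableSet.iUnion fun _ =>
    measurableSet_exists_nnOrder hK σ (fun _ _ => 1) continuous_const 0

theorem measurable_knnSupError {d n : ℕ} {K : Set (EuclideanSpace ℝ (Fin d))}
    (hK : IsCompact K) {f : EuclideanSpace ℝ (Fin d) → ℝ} (hf : ContinuousOn f K) (k : ℕ) :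
    Measurable fun w : Fin n → EuclideanSpace ℝ (Fin d) × ℝ =>
      knnSupError K f k (fun i => (w i).1) (fun i => (w i).2) := by
  refine measurable_of_Ioi fun s => ?_
  rcases eq_or_ne s ⊤ with rfl | hs
  · simp
  let G : Equiv.Perm (Fin n) → (Fin n → EuclideanSpace ℝ (Fin d) × ℝ) →
      EuclideanSpace ℝ (Fin d) → ℝ := fun σ w x =>
    |(1 / (k : ℝ)) * ∑ i ∈ Finset.univ.filter (fun i : Fin n => (i : ℕ) < k), (w (σ i)).2 - f x|
  have heq : (fun w : Fin n → EuclideanSpace ℝ (Fin d) × ℝ =>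
      knnSupError K f k (fun i => (w i).1) (fun i => (w i).2)) ⁻¹' Set.Ioi s =
      ⋃ σ : Equiv.Perm (Fin n),
        {w | ∃ x ∈ K, nnOrder (fun i => (w i).1) x = σ ∧ s.toReal < G σ w x} := by
    ext w
    simp only [Set.mem_preimage, Set.mem_Ioi, knnSupError, lt_iSup_iff, Set.mem_iUnion,
      Set.mem_ofPred_eq, ENNReal.lt_ofReal_iff_toReal_lt hs, exists_prop]
    constructor
    · rintro ⟨x, hx, h⟩
      exact ⟨_, x, hx, rfl, h⟩
    · rintro ⟨σ, x, hx, rfl, h⟩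
      exact ⟨x, hx, h⟩
  rw [heq]
  refine MeasurableSet.iUnion fun σ => measurableSet_exists_nnOrder hK σ (G σ) ?_ _
  have hfK : Continuous fun x : K => f x := continuousOn_iff_continuous_domRestrict.1 hf
  have : Continuous fun q : (Fin n → EuclideanSpace ℝ (Fin d) × ℝ) × K => f q.2 :=
    hfK.comp continuous_snd
  exact ((continuous_const.mul (continuous_finsetSum _ fun i _ => by fun_prop)).sub this).abs

theorem lintegral_pi_mul_prod_le {Z : Type*} [MeasurableSpace Z] {n : ℕ} (P : Measure Z)
    [IsProbabilityMeasure P] {g : Z → ℝ≥0∞} (hg : Measurable g) (c : ℝ≥0∞)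
    {H : (Fin n → Z) → ℝ≥0∞} (hH : Measurable H) (S : Finset (Fin n))
    (h : ∀ i ∈ S, ∀ w : Fin n → Z,
      ∫⁻ z, H (Function.update w i z) * g z ∂P ≤ c * ∫⁻ z, H (Function.update w i z) ∂P) :
    ∫⁻ w, H w * ∏ i ∈ S, g (w i) ∂Measure.pi (fun _ => P) ≤
      c ^ S.card * ∫⁻ w, H w ∂Measure.pi (fun _ => P) := by
  induction S using Finset.induction_on with
  | empty => simp
  | insert i S hi ih =>
    have hprod : Measurable fun w : Fin n → Z => ∏ j ∈ S, g (w j) :=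
      Finset.measurable_prod _ fun j _ => hg.comp (measurable_pi_apply j)
    have hgi : Measurable fun w : Fin n → Z => g (w i) := hg.comp (measurable_pi_apply i)
    calc ∫⁻ w, H w * ∏ j ∈ insert i S, g (w j) ∂Measure.pi (fun _ => P)
        ≤ ∫⁻ w, c * (H w * ∏ j ∈ S, g (w j)) ∂Measure.pi (fun _ => P) := by
          refine lintegral_le_of_lmarginal_le (μ := fun _ => P) {i} ?_ ?_ ?_
          · simp only [Finset.prod_insert hi]
            exact hH.mul (hgi.mul hprod)
          · exact (hH.mul hprod).const_mul c
          · intro w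
            simp only [lmarginal_singleton, Finset.prod_insert hi, Function.update_self]
            have hupd : ∀ z, ∏ j ∈ S, g (Function.update w i z j) = ∏ j ∈ S, g (w j) := fun z =>
              Finset.prod_congr rfl fun j hj => by
                rw [Function.update_of_ne (ne_of_mem_of_not_mem hj hi)]
            have hu : Measurable fun z => H (Function.update w i z) :=
              hH.comp (measurable_update w)
            simp only [hupd]
            calc ∫⁻ z, H (Function.update w i z) * (g z * ∏ j ∈ S, g (w j)) ∂P
                = (∫⁻ z, H (Function.update w i z) * g z ∂P) * ∏ j ∈ S, g (w j) := by
                  have hug : Measurable fun z => H (Function.update w i z) * g z := hu.mul hg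
                  rw [← lintegral_mul_const _ hug]
                  simp only [mul_assoc]
              _ ≤ (c * ∫⁻ z, H (Function.update w i z) ∂P) * ∏ j ∈ S, g (w j) := by
                  gcongr
                  exact h i (Finset.mem_insert_self i S) w
              _ = ∫⁻ z, c * (H (Function.update w i z) * ∏ j ∈ S, g (w j)) ∂P := by
                  rw [lintegral_const_mul _ (hu.mul_const _), lintegral_mul_const _ hu, mul_assoc]
      _ = c * ∫⁻ w, H w * ∏ j ∈ S, g (w j) ∂Measure.pi (fun _ => P) :=
          lintegral_const_mul _ (hH.mul hprod)
      _ ≤ c * (c ^ S.card * ∫⁻ w, H w ∂Measure.pi (fun _ => P)) := by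
          gcongr
          exact ih fun j hj => h j (Finset.mem_insert_of_mem hj)
      _ = c ^ (insert i S).card * ∫⁻ w, H w ∂Measure.pi (fun _ => P) := by
          rw [Finset.card_insert_of_notMem hi, pow_succ']
          ring

theorem UniformNoise.lintegral_mul_exp_le {d : ℕ} {P : Measure (EuclideanSpace ℝ (Fin d) × ℝ)}
    [IsProbabilityMeasure P] {f : EuclideanSpace ℝ (Fin d) → ℝ} {c₀ : ℝ}
    (hP : UniformNoise P f c₀) {t : ℝ} (ht : |t| ≤ 1 / c₀)
    {φ : EuclideanSpace ℝ (Fin d) → ℝ≥0∞} (hφ : Measurable φ) :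
    ∫⁻ z, φ z.1 * ENNReal.ofReal (Real.exp (t * (z.2 - f z.1))) ∂P ≤
      ENNReal.ofReal (Real.exp (c₀ ^ 2 * t ^ 2)) * ∫⁻ z, φ z.1 ∂P := by
  obtain ⟨hint, hle⟩ := hP t ht
  set g : EuclideanSpace ℝ (Fin d) × ℝ → ℝ := fun z => Real.exp (t * (z.2 - f z.1)) with hgdef
  set c : ℝ := Real.exp (c₀ ^ 2 * t ^ 2)
  have hm : featureSigma d ≤ (inferInstance : MeasurableSpace (EuclideanSpace ℝ (Fin d) × ℝ)) :=
    measurable_fst.comap_le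
  have hgm : AEMeasurable (fun z => ENNReal.ofReal (g z)) P :=
    hint.aestronglyMeasurable.aemeasurable.ennreal_ofReal
  have hν : (P.withDensity fun z => ENNReal.ofReal (g z)).map Prod.fst ≤
      ENNReal.ofReal c • P.map Prod.fst := by
    refine Measure.le_iff.2 fun A hA => ?_
    have hA' : MeasurableSet (Prod.fst ⁻¹' A : Set (EuclideanSpace ℝ (Fin d) × ℝ)) :=
      measurable_fst hA
    rw [Measure.map_apply measurable_fst hA, withDensity_apply _ hA', Measure.smul_apply,
      Measure.map_apply measurable_fst hA, smul_eq_mul,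
      ← ofReal_integral_eq_lintegral_ofReal hint.integrableOn
        (ae_of_all _ fun z => (Real.exp_pos _).le),
      ← setIntegral_condExp hm hint ⟨A, hA, rfl⟩,
      ← ENNReal.ofReal_toReal (measure_ne_top P _), ← ENNReal.ofReal_mul (Real.exp_pos _).le]
    refine ENNReal.ofReal_le_ofReal ?_
    calc ∫ z in Prod.fst ⁻¹' A, (P[g | featureSigma d]) z ∂P
        ≤ ∫ z in Prod.fst ⁻¹' A, c ∂P :=
          setIntegral_mono_ae integrable_condExp.integrableOn
            (integrable_const c).integrableOn hle
      _ = c * (P (Prod.fst ⁻¹' A)).toReal := by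
          rw [setIntegral_const, smul_eq_mul, mul_comm]; rfl
  calc ∫⁻ z, φ z.1 * ENNReal.ofReal (g z) ∂P
      = ∫⁻ x, φ x ∂(P.withDensity fun z => ENNReal.ofReal (g z)).map Prod.fst := by
        have hφ' : Measurable fun z : EuclideanSpace ℝ (Fin d) × ℝ => φ z.1 :=
          hφ.comp measurable_fst
        rw [lintegral_map hφ measurable_fst,
          lintegral_withDensity_eq_lintegral_mul₀ hgm hφ'.aemeasurable]
        simp only [Pi.mul_apply, mul_comm]
    _ ≤ ∫⁻ x, φ x ∂(ENNReal.ofReal c • P.map Prod.fst) := lintegral_mono' hν le_rfl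
    _ = ENNReal.ofReal c * ∫⁻ z, φ z.1 ∂P := by
        rw [lintegral_smul_measure, lintegral_map hφ measurable_fst, smul_eq_mul]

theorem rpow_le_mul_exp {p c z : ℝ} (hp : 0 < p) (hc : 0 < c) (hz : 0 ≤ z) :
    z ^ p ≤ (p / c) ^ p * Real.exp (c * z) := by
  have h1 : z = p / c * (c * z / p) := by field_simp
  have h2 : c * z / p ≤ Real.exp (c * z / p) :=
    (by linarith : c * z / p ≤ c * z / p + 1).trans (Real.add_one_le_exp _)
  calc z ^ p = (p / c) ^ p * (c * z / p) ^ p := by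
        rw [← Real.mul_rpow (by positivity) (by positivity), ← h1]
    _ ≤ (p / c) ^ p * Real.exp (c * z / p) ^ p := by
        gcongr
    _ = (p / c) ^ p * Real.exp (c * z) := by
        rw [← Real.exp_mul]; congr 2; field_simp

theorem rpow_le_rpow_add_exp {p z l : ℝ} (hp : 0 < p) (hz : 0 ≤ z) (hl : 0 ≤ l) :
    z ^ p ≤ l ^ p + (2 * p) ^ p * Real.exp (-(l / 2)) * Real.exp z := by
  rcases le_total z l with h | h
  · have := Real.rpow_le_rpow hz h hp.le
    have : 0 ≤ (2 * p) ^ p * Real.exp (-(l / 2)) * Real.exp z := by positivity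
    linarith
  · have h1 := rpow_le_mul_exp hp (by norm_num : (0 : ℝ) < 1 / 2) hz
    have h2 : (0 : ℝ) ≤ l ^ p := by positivity
    calc z ^ p ≤ (p / (1 / 2)) ^ p * Real.exp (1 / 2 * z) := h1
      _ = (2 * p) ^ p * Real.exp (1 / 2 * z) := by congr 2; ring
      _ ≤ (2 * p) ^ p * Real.exp (-(l / 2) + z) := by gcongr; linarith
      _ = (2 * p) ^ p * Real.exp (-(l / 2)) * Real.exp z := by rw [Real.exp_add, mul_assoc]
      _ ≤ _ := by linarith

theorem StrongDensity.le_measure_closedBall {d : ℕ} {Q : Measure (EuclideanSpace ℝ (Fin d))}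
    {K : Set (EuclideanSpace ℝ (Fin d))} {μmin μmax c : ℝ} (hKm : MeasurableSet K)
    (hQ : StrongDensity Q K μmin μmax) (hμ : 0 < μmin) (hc : 0 < c)
    {x : EuclideanSpace ℝ (Fin d)} {r : ℝ} (hr : 0 ≤ r)
    (hreg : ENNReal.ofReal c * volume (Metric.closedBall x r) ≤
      volume (K ∩ Metric.closedBall x r)) :
    ENNReal.ofReal (μmin * c *
      volume.real (Metric.ball (0 : EuclideanSpace ℝ (Fin d)) 1) * r ^ d) ≤
      Q (Metric.closedBall x r) := by
  obtain ⟨-, μ, -, rfl, hb⟩ := hQ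
  have hB : MeasurableSet (Metric.closedBall x r) := Metric.isClosed_closedBall.measurableSet
  calc ENNReal.ofReal (μmin * c *
      volume.real (Metric.ball (0 : EuclideanSpace ℝ (Fin d)) 1) * r ^ d)
      = ENNReal.ofReal μmin * (ENNReal.ofReal c * volume (Metric.closedBall x r)) := by
        rw [Measure.addHaar_closedBall _ _ hr, finrank_euclideanSpace_fin,
          ENNReal.ofReal_mul (by positivity), ENNReal.ofReal_mul (by positivity),
          ENNReal.ofReal_mul (by positivity), Measure.real,
          ENNReal.ofReal_toReal measure_ball_lt_top.ne]
        ring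
    _ ≤ ENNReal.ofReal μmin * volume (K ∩ Metric.closedBall x r) := by gcongr
    _ = ∫⁻ _ in K ∩ Metric.closedBall x r, ENNReal.ofReal μmin := by
        rw [lintegral_const, Measure.restrict_apply_univ]
    _ ≤ ∫⁻ y in K ∩ Metric.closedBall x r, ENNReal.ofReal (μ y) :=
        setLIntegral_mono' (hKm.inter hB) fun y hy => ENNReal.ofReal_le_ofReal (hb y hy.1).1
    _ = (volume.withDensity fun y => ENNReal.ofReal (μ y)) (K ∩ Metric.closedBall x r) :=
        (withDensity_apply _ (hKm.inter hB)).symm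
    _ ≤ _ := measure_mono Set.inter_subset_right

theorem card_mul_le_one_of_separated {E : Type*} [PseudoMetricSpace E] [MeasurableSpace E]
    [OpensMeasurableSpace E] (Q : Measure E) [IsProbabilityMeasure Q] {r q : ℝ}
    {s : Finset E} (hs : ∀ x ∈ s, ENNReal.ofReal q ≤ Q (Metric.closedBall x (r / 2)))
    (hsep : ∀ x ∈ s, ∀ y ∈ s, x ≠ y → r < dist x y) : (s.card : ℝ) * q ≤ 1 := by
  have h1 : Q (⋃ x ∈ s, Metric.closedBall x (r / 2)) =
      ∑ x ∈ s, Q (Metric.closedBall x (r / 2)) := by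
    refine measure_biUnion_finset ?_ fun x _ => Metric.isClosed_closedBall.measurableSet
    intro x hx y hy hxy
    exact Metric.closedBall_disjoint_closedBall (by linarith [hsep x hx y hy hxy])
  have h2 : ∑ _x ∈ s, ENNReal.ofReal q ≤ 1 :=
    (Finset.sum_le_sum hs).trans (h1 ▸ prob_le_one)
  rw [Finset.sum_const, nsmul_eq_mul, ← ENNReal.ofReal_natCast,
    ← ENNReal.ofReal_mul (by positivity)] at h2
  exact ENNReal.ofReal_le_one.1 h2

theorem exists_finset_net {E : Type*} [PseudoMetricSpace E] [MeasurableSpace E]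
    [OpensMeasurableSpace E] (Q : Measure E) [IsProbabilityMeasure Q] (K : Set E) {r q : ℝ}
    (hr : 0 ≤ r) (hq : 0 < q) (hK : ∀ x ∈ K, ENNReal.ofReal q ≤ Q (Metric.closedBall x (r / 2))) :
    ∃ s : Finset E, ↑s ⊆ K ∧ (s.card : ℝ) * q ≤ 1 ∧ ∀ x ∈ K, ∃ y ∈ s, dist x y ≤ r := by
  classical
  by_contra! hcon
  have h : ∀ m : ℕ, ∃ s : Finset E, ↑s ⊆ K ∧ (∀ x ∈ s, ∀ y ∈ s, x ≠ y → r < dist x y) ∧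
      s.card = m := by
    intro m
    induction m with
    | zero => exact ⟨∅, by simp⟩
    | succ m ih =>
      obtain ⟨s, hsK, hsep, rfl⟩ := ih
      obtain ⟨x, hxK, hx⟩ := hcon s hsK
        (card_mul_le_one_of_separated Q (fun x hx => hK x (hsK hx)) hsep)
      have hxs : x ∉ s := fun hmem => by simpa [hr.not_gt] using hx x hmem
      refine ⟨insert x s, ?_, ?_, Finset.card_insert_of_notMem hxs⟩
      · rw [Finset.coe_insert]
        exact Set.insert_subset hxK hsK
      · intro y hy z hz hyz
        rcases Finset.mem_insert.1 hy with rfl | hys <;>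
          rcases Finset.mem_insert.1 hz with rfl | hzs
        · exact absurd rfl hyz
        · exact hx z hzs
        · rw [dist_comm]; exact hx y hys
        · exact hsep y hys z hzs hyz
  obtain ⟨m, hm⟩ := exists_nat_gt (1 / q)
  obtain ⟨s, hsK, hsep, rfl⟩ := h m
  have := card_mul_le_one_of_separated Q (fun x hx => hK x (hsK hx)) hsep
  rw [div_lt_iff₀ hq] at hm
  linarith

/-- A Chernoff bound for the number of sample points in a set. -/
theorem measure_card_mem_lt_le {E : Type*} [MeasurableSpace E] (P : Measure (E × ℝ))
    [IsProbabilityMeasure P] {B : Set E} [DecidablePred (· ∈ B)] (hB : MeasurableSet B) {q : ℝ}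
    (hq : ENNReal.ofReal q ≤ P.fst B) (n k : ℕ) :
    Measure.pi (fun _ : Fin n => P)
      {w | (Finset.univ.filter fun i => (w i).1 ∈ B).card < k} ≤
      ENNReal.ofReal (Real.exp (k - n * q / 2)) := by
  let g : E × ℝ → ℝ≥0∞ := fun z => if z.1 ∈ B then ENNReal.ofReal (Real.exp (-1)) else 1
  have hB' : MeasurableSet {z : E × ℝ | z.1 ∈ B} := measurable_fst hB
  have hg : Measurable g := Measurable.ite hB' measurable_const measurable_const
  have hgint : ∫⁻ z, g z ∂P ≤ ENNReal.ofReal (Real.exp (-(q / 2))) := by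
    have hPB : P {z : E × ℝ | z.1 ∈ B} = P.fst B := (Measure.fst_apply hB).symm
    have hle : q ≤ (P.fst B).toReal := (ENNReal.ofReal_le_iff_le_toReal (measure_ne_top _ _)).1 hq
    have hexp : Real.exp (-1) ≤ 1 / 2 := by
      rw [Real.exp_neg, one_div]
      exact inv_anti₀ (by norm_num) (by linarith [Real.exp_one_gt_d9])
    have hpos : 0 ≤ (P.fst B).toReal := ENNReal.toReal_nonneg
    have hle1 : (P.fst B).toReal ≤ 1 := measureReal_le_one
    have hg1 : Set.EqOn g (fun _ => ENNReal.ofReal (Real.exp (-1))) {z | z.1 ∈ B} :=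
      fun z hz => if_pos hz
    have hg2 : Set.EqOn g (fun _ => 1) {z | z.1 ∈ B}ᶜ := fun z hz => if_neg hz
    rw [← lintegral_add_compl _ hB', setLIntegral_congr_fun hB' hg1, setLIntegral_congr_fun hB'.compl hg2,
      setLIntegral_const, setLIntegral_one, prob_compl_eq_one_sub hB', hPB,
      ← ENNReal.ofReal_toReal (measure_ne_top P.fst B), ← ENNReal.ofReal_one,
      ← ENNReal.ofReal_sub _ hpos, ← ENNReal.ofReal_mul (Real.exp_pos _).le,
      ← ENNReal.ofReal_add (by positivity) (by linarith)]
    refine ENNReal.ofReal_le_ofReal ?_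
    have := Real.add_one_le_exp (-(q / 2))
    nlinarith
  have hmain := lintegral_pi_mul_prod_le (n := n) P hg (ENNReal.ofReal (Real.exp (-(q / 2))))
    (H := fun _ => 1) measurable_const Finset.univ (fun i _ w => by simpa using hgint)
  simp only [one_mul, lintegral_const, measure_univ, mul_one, Finset.card_univ,
    Fintype.card_fin] at hmain
  have hprod : Measurable fun w : Fin n → E × ℝ => ∏ i, g (w i) :=
    Finset.measurable_prod _ fun j _ => hg.comp (measurable_pi_apply j)
  have hpt : ∀ w : Fin n → E × ℝ, (Finset.univ.filter fun i => (w i).1 ∈ B).card < k →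
      ENNReal.ofReal (Real.exp (-k)) ≤ ∏ i, g (w i) := by
    intro w hw
    simp only [g, Finset.prod_ite, Finset.prod_const, one_pow, mul_one]
    rw [← ENNReal.ofReal_pow (Real.exp_pos _).le, ← Real.exp_nat_mul]
    refine ENNReal.ofReal_le_ofReal (Real.exp_le_exp.2 ?_)
    have : ((Finset.univ.filter fun i => (w i).1 ∈ B).card : ℝ) ≤ k := by exact_mod_cast hw.le
    linarith
  have hmarkov := mul_meas_ge_le_lintegral (μ := Measure.pi (fun _ : Fin n => P)) hprod
    (ENNReal.ofReal (Real.exp (-k)))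
  calc Measure.pi (fun _ : Fin n => P) {w | (Finset.univ.filter fun i => (w i).1 ∈ B).card < k}
      ≤ Measure.pi (fun _ : Fin n => P) {w | ENNReal.ofReal (Real.exp (-k)) ≤ ∏ i, g (w i)} :=
        measure_mono hpt
    _ = ENNReal.ofReal (Real.exp k) * (ENNReal.ofReal (Real.exp (-k)) *
        Measure.pi (fun _ : Fin n => P) {w | ENNReal.ofReal (Real.exp (-k)) ≤ ∏ i, g (w i)}) := by
        rw [← mul_assoc, ← ENNReal.ofReal_mul (Real.exp_pos _).le, ← Real.exp_add]
        simp
    _ ≤ ENNReal.ofReal (Real.exp k) * ENNReal.ofReal (Real.exp (-(q / 2))) ^ n := by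
        gcongr
        exact hmarkov.trans hmain
    _ = ENNReal.ofReal (Real.exp (k - n * q / 2)) := by
        rw [← ENNReal.ofReal_pow (Real.exp_pos _).le, ← ENNReal.ofReal_mul (Real.exp_pos _).le,
          ← Real.exp_nat_mul, ← Real.exp_add]
        congr 2
        ring

theorem norm_sub_le_of_mem_nnSet {d n k : ℕ} {X : Fin n → EuclideanSpace ℝ (Fin d)}
    {x : EuclideanSpace ℝ (Fin d)} {R : ℝ} (hk : k ≤ n)
    (hcard : k ≤ (Finset.univ.filter fun i => ‖X i - x‖ ≤ R).card) {i : Fin n}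
    (hi : i ∈ nnSet k X x) : ‖X i - x‖ ≤ R := by
  by_contra! hR
  have hsub : (Finset.univ.filter fun i => ‖X i - x‖ ≤ R) ⊂ nnSet k X x := by
    refine Finset.ssubset_iff_subset_ne.2 ⟨fun j hj => ?_, fun heq => ?_⟩
    · simp only [Finset.mem_filter, Finset.mem_univ, true_and] at hj
      by_contra hjS
      rcases dist_lt_or_eq_of_mem_nnSet hi hjS with h | h
      · linarith
      · linarith [h.1]
    · rw [← heq] at hi
      simp only [Finset.mem_filter, Finset.mem_univ, true_and] at hi
      linarith
  have := Finset.card_lt_card hsub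
  rw [card_nnSet hk] at this
  omega

theorem abs_mean_le {ι : Type*} {S : Finset ι} {k : ℕ} (hS : S.card = k) {v : ι → ℝ} {b : ℝ}
    (hb : 0 ≤ b) (hv : ∀ i ∈ S, |v i| ≤ b) : |(1 / (k : ℝ)) * ∑ i ∈ S, v i| ≤ b := by
  rcases Nat.eq_zero_or_pos k with rfl | hk
  · simpa using hb
  have hk' : (0 : ℝ) < k := by exact_mod_cast hk
  rw [abs_mul, abs_of_pos (by positivity), one_div, inv_mul_le_iff₀ hk']
  calc |∑ i ∈ S, v i| ≤ ∑ i ∈ S, |v i| := Finset.abs_sum_le_sum_abs _ _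
    _ ≤ ∑ i ∈ S, b := Finset.sum_le_sum hv
    _ = k * b := by rw [Finset.sum_const, hS, nsmul_eq_mul]

theorem measurable_card_filter {Z : Type*} [MeasurableSpace Z] {n : ℕ} {A : Set Z}
    [DecidablePred (· ∈ A)] (hA : MeasurableSet A) :
    Measurable fun w : Fin n → Z => (Finset.univ.filter fun i => w i ∈ A).card := by
  simp only [Finset.card_filter]
  exact Finset.measurable_sum _ fun i _ =>
    Measurable.ite (measurable_pi_apply i hA) measurable_const measurable_const

/-- The bias of the nearest-neighbour estimator has a measurable majorant with small mean. -/
theorem exists_bias_majorant {d n k : ℕ} (hd : 1 ≤ d)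
    (P : Measure (EuclideanSpace ℝ (Fin d) × ℝ)) [IsProbabilityMeasure P]
    {K : Set (EuclideanSpace ℝ (Fin d))} {f : EuclideanSpace ℝ (Fin d) → ℝ} {L : NNReal}
    (hf : LipschitzWith L f) {κ r₀ D p : ℝ} (hκ : 0 < κ) (hr₀ : 0 < r₀) (hD : 0 ≤ D) (hp : 0 < p)
    (hmass : ∀ x ∈ K, ∀ r, 0 < r → r ≤ r₀ →
      ENNReal.ofReal (κ * r ^ d) ≤ P.fst (Metric.closedBall x r))
    (hdiam : ∀ x ∈ K, ∀ y ∈ K, dist x y ≤ D) (hk : 1 ≤ k) (hkn : k ≤ n) :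
    ∃ H : (Fin n → EuclideanSpace ℝ (Fin d) × ℝ) → ℝ≥0∞, Measurable H ∧
      (∀ w, (∀ i, (w i).1 ∈ K) → ∀ x ∈ K,
        ENNReal.ofReal |(1 / (k : ℝ)) * ∑ i ∈ nnSet k (fun i => (w i).1) x,
          (f (w i).1 - f x)| ^ p ≤ H w) ∧
      ∫⁻ w, H w ∂Measure.pi (fun _ => P) ≤ ENNReal.ofReal
        (((2 * L + L * D / r₀) * (4 * k / (κ * n)) ^ (1 / (d : ℝ))) ^ p +
          (L * D) ^ p * (2 ^ d * (n * Real.exp (-k)))) := by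
  classical
  have hk0 : (0 : ℝ) < k := by exact_mod_cast hk
  have hn0 : (0 : ℝ) < n := by exact_mod_cast hk.trans hkn
  have hL : (0 : ℝ) ≤ L := L.2
  set r : ℝ := (4 * k / (κ * n)) ^ (1 / (d : ℝ)) with hr
  have hrpos : 0 < r := by positivity
  have hrd : r ^ d = 4 * k / (κ * n) := by
    rw [hr, one_div, Real.rpow_inv_natCast_pow (by positivity) (by omega)]
  have hLD : ∀ w : Fin n → EuclideanSpace ℝ (Fin d) × ℝ, (∀ i, (w i).1 ∈ K) → ∀ x ∈ K,
      |(1 / (k : ℝ)) * ∑ i ∈ nnSet k (fun i => (w i).1) x, (f (w i).1 - f x)| ≤ L * D := by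
    intro w hw x hx
    refine abs_mean_le (card_nnSet hkn _ _) (by positivity) fun i _ => ?_
    rw [← Real.dist_eq]
    exact (hf.dist_le_mul _ _).trans (by gcongr; exact hdiam _ (hw i) _ hx)
  rcases le_total r r₀ with hrr | hrr
  · obtain ⟨s, hsK, hscard, hsnet⟩ := exists_finset_net P.fst K (r := r) (q := κ * (r / 2) ^ d)
      hrpos.le (by positivity) (fun x hx => hmass x hx _ (by positivity) (by linarith))
    let bad : EuclideanSpace ℝ (Fin d) → Set (Fin n → EuclideanSpace ℝ (Fin d) × ℝ) := fun y =>
      {w | (Finset.univ.filter fun i => (w i).1 ∈ Metric.closedBall y r).card < k}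
    have hbadm : ∀ y, MeasurableSet (bad y) := fun y =>
      measurable_card_filter (A := Prod.fst ⁻¹' Metric.closedBall y r)
        (measurable_fst Metric.isClosed_closedBall.measurableSet) measurableSet_Iio
    have hbadle : ∀ y ∈ s, Measure.pi (fun _ : Fin n => P) (bad y) ≤
        ENNReal.ofReal (Real.exp (-k)) := by
      intro y hy
      refine (measure_card_mem_lt_le P Metric.isClosed_closedBall.measurableSet
        (hmass y (hsK hy) r hrpos hrr) n k).trans_eq ?_
      rw [hrd]
      congr 2
      field_simp
      ring
    have hsum : Measurable fun w => ∑ y ∈ s, (bad y).indicator (fun _ => (1 : ℝ≥0∞)) w :=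
      Finset.measurable_sum _ fun y _ => measurable_const.indicator (hbadm y)
    refine ⟨fun w => ENNReal.ofReal (((2 * L + L * D / r₀) * r) ^ p) +
      ENNReal.ofReal ((L * D) ^ p) * ∑ y ∈ s, (bad y).indicator (fun _ => 1) w,
      (hsum.const_mul _).const_add _, ?_, ?_⟩
    · intro w hw x hx
      rw [ENNReal.ofReal_rpow_of_nonneg (abs_nonneg _) hp.le]
      by_cases hgood : ∃ y ∈ s, w ∈ bad y
      · obtain ⟨y, hy, hyw⟩ := hgood
        have h1 : (1 : ℝ≥0∞) ≤ ∑ y ∈ s, (bad y).indicator (fun _ => 1) w := by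
          calc (1 : ℝ≥0∞) = (bad y).indicator (fun _ => 1) w := by
                rw [Set.indicator_of_mem hyw]
            _ ≤ _ := Finset.single_le_sum
                (f := fun y => (bad y).indicator (fun _ => (1 : ℝ≥0∞)) w)
                (fun _ _ => zero_le) hy
        refine le_add_left ((ENNReal.ofReal_le_ofReal
          (Real.rpow_le_rpow (abs_nonneg _) (hLD w hw x hx) hp.le)).trans ?_)
        exact le_mul_of_one_le_right zero_le h1
      · refine le_add_right (ENNReal.ofReal_le_ofReal
          (Real.rpow_le_rpow (abs_nonneg _) ?_ hp.le))
        obtain ⟨y, hy, hxy⟩ := hsnet x hx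
        have hcard : k ≤ (Finset.univ.filter fun i => (w i).1 ∈ Metric.closedBall y r).card :=
          not_lt.1 fun h => hgood ⟨y, hy, h⟩
        have hcard2 : k ≤ (Finset.univ.filter fun i => ‖(w i).1 - x‖ ≤ 2 * r).card := by
          refine hcard.trans (Finset.card_le_card fun i hi => ?_)
          simp only [Finset.mem_filter, Finset.mem_univ, true_and, Metric.mem_closedBall] at hi ⊢
          rw [← dist_eq_norm]
          linarith [dist_triangle_right (w i).1 x y]
        have h2 : |(1 / (k : ℝ)) * ∑ i ∈ nnSet k (fun i => (w i).1) x, (f (w i).1 - f x)| ≤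
            L * (2 * r) := by
          refine abs_mean_le (card_nnSet hkn _ _) (by positivity) fun i hi => ?_
          rw [← Real.dist_eq]
          refine (hf.dist_le_mul _ _).trans ?_
          gcongr
          rw [dist_eq_norm]
          exact norm_sub_le_of_mem_nnSet hkn hcard2 hi
        have h3 : 0 ≤ L * D / r₀ * r := by positivity
        linarith
    · have hN : (s.card : ℝ) ≤ 2 ^ d * n := by
        rw [div_pow, hrd] at hscard
        have h1 : (1 : ℝ) ≤ k := by exact_mod_cast hk
        have h2 : (s.card : ℝ) * (4 * k) ≤ 2 ^ d * n := by
          have : (s.card : ℝ) * (κ * (4 * k / (κ * n) / 2 ^ d)) =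
            s.card * (4 * k) / (2 ^ d * n) := by field_simp
          rw [this, div_le_one (by positivity)] at hscard
          exact hscard
        have h3 : (0 : ℝ) ≤ s.card := by positivity
        nlinarith
      rw [lintegral_add_left measurable_const, lintegral_const, measure_univ, mul_one,
        lintegral_const_mul _ hsum, lintegral_finsetSum _
          fun y _ => measurable_const.indicator (hbadm y),
        ENNReal.ofReal_add (by positivity) (by positivity),
        ENNReal.ofReal_mul (p := (L * D) ^ p) (by positivity)]
      gcongr
      calc ∑ y ∈ s, ∫⁻ w, (bad y).indicator (fun _ => 1) w ∂Measure.pi (fun _ => P)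
          ≤ ∑ _y ∈ s, ENNReal.ofReal (Real.exp (-k)) :=
            Finset.sum_le_sum fun y hy => by
              rw [lintegral_indicator_const (hbadm y), one_mul]
              exact hbadle y hy
        _ = ENNReal.ofReal (s.card * Real.exp (-k)) := by
            rw [Finset.sum_const, nsmul_eq_mul, ENNReal.ofReal_mul (by positivity),
              ENNReal.ofReal_natCast]
        _ ≤ ENNReal.ofReal (2 ^ d * (n * Real.exp (-k))) := by
            rw [← mul_assoc]
            gcongr
  · refine ⟨fun _ => ENNReal.ofReal (((2 * L + L * D / r₀) * r) ^ p), measurable_const, ?_, ?_⟩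
    · intro w hw x hx
      rw [ENNReal.ofReal_rpow_of_nonneg (abs_nonneg _) hp.le]
      refine ENNReal.ofReal_le_ofReal (Real.rpow_le_rpow (abs_nonneg _) ?_ hp.le)
      refine (hLD w hw x hx).trans ?_
      have h1 : L * D ≤ L * D / r₀ * r := by
        rw [div_mul_eq_mul_div, le_div_iff₀ hr₀]
        gcongr
      have h2 : 0 ≤ 2 * L * r := by positivity
      linarith
    · rw [lintegral_const, measure_univ, mul_one]
      refine ENNReal.ofReal_le_ofReal (le_add_of_nonneg_right ?_)
      positivity

theorem lintegral_nnFamily_mul_exp_le {d n k : ℕ}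
    (P : Measure (EuclideanSpace ℝ (Fin d) × ℝ)) [IsProbabilityMeasure P]
    {K : Set (EuclideanSpace ℝ (Fin d))} (hK : IsCompact K)
    {f : EuclideanSpace ℝ (Fin d) → ℝ} (hf : Measurable f) {c₀ t : ℝ}
    (hP : UniformNoise P f c₀) (ht : |t| ≤ 1 / c₀) (S : Finset (Fin n)) :
    ∫⁻ w, {w : Fin n → EuclideanSpace ℝ (Fin d) × ℝ |
        S ∈ nnFamily K k fun i => (w i).1}.indicator (fun _ => 1) w *
        ∏ i ∈ S, ENNReal.ofReal (Real.exp (t * ((w i).2 - f (w i).1)))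
        ∂Measure.pi (fun _ => P) ≤
      ENNReal.ofReal (Real.exp (c₀ ^ 2 * t ^ 2)) ^ S.card *
        Measure.pi (fun _ => P) {w : Fin n → EuclideanSpace ℝ (Fin d) × ℝ |
          S ∈ nnFamily K k fun i => (w i).1} := by
  have hA := measurableSet_mem_nnFamily (n := n) hK k S
  set A := {w : Fin n → EuclideanSpace ℝ (Fin d) × ℝ | S ∈ nnFamily K k fun i => (w i).1}
    with hAdef
  have hH : Measurable (A.indicator fun _ => (1 : ℝ≥0∞)) := measurable_const.indicator hA
  have hg : Measurable fun z : EuclideanSpace ℝ (Fin d) × ℝ =>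
      ENNReal.ofReal (Real.exp (t * (z.2 - f z.1))) := by fun_prop
  rw [← one_mul (Measure.pi (fun _ => P) A), ← lintegral_indicator_const hA]
  refine lintegral_pi_mul_prod_le P hg _ hH S fun i _ w => ?_
  have hfst : ∀ z : EuclideanSpace ℝ (Fin d) × ℝ,
      A.indicator (fun _ => (1 : ℝ≥0∞)) (Function.update w i z) =
      A.indicator (fun _ => (1 : ℝ≥0∞)) (Function.update w i (z.1, 0)) := by
    intro z
    have : (fun j => (Function.update w i z j).1) =
        fun j => (Function.update w i (z.1, (0 : ℝ)) j).1 := by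
      funext j
      rcases eq_or_ne j i with rfl | hj
      · simp
      · simp [hj]
    simp only [Set.indicator, hAdef, Set.mem_ofPred_eq, this]
  simp only [hfst]
  refine hP.lintegral_mul_exp_le ht
    (φ := fun x => A.indicator (fun _ => (1 : ℝ≥0∞)) (Function.update w i (x, 0))) ?_
  exact hH.comp ((measurable_update w).comp (measurable_id.prodMk measurable_const))

theorem sum_measure_mem_nnFamily_le {d n k : ℕ}
    (P : Measure (EuclideanSpace ℝ (Fin d) × ℝ)) [IsProbabilityMeasure P]
    {K : Set (EuclideanSpace ℝ (Fin d))} (hK : IsCompact K) (𝒮 : Finset (Finset (Fin n))) :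
    ∑ S ∈ 𝒮, Measure.pi (fun _ => P) {w : Fin n → EuclideanSpace ℝ (Fin d) × ℝ |
      S ∈ nnFamily K k fun i => (w i).1} ≤ ((n + 1) ^ (d + 3) : ℕ) := by
  classical
  have hA := fun S => measurableSet_mem_nnFamily (n := n) hK k S
  calc ∑ S ∈ 𝒮, Measure.pi (fun _ => P) {w : Fin n → EuclideanSpace ℝ (Fin d) × ℝ |
      S ∈ nnFamily K k fun i => (w i).1}
      = ∫⁻ w, ∑ S ∈ 𝒮, {w : Fin n → EuclideanSpace ℝ (Fin d) × ℝ |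
        S ∈ nnFamily K k fun i => (w i).1}.indicator (fun _ => 1) w
          ∂Measure.pi (fun _ => P) := by
        rw [lintegral_finsetSum _ fun S _ => measurable_const.indicator (hA S)]
        exact Finset.sum_congr rfl fun S _ => by
          rw [lintegral_indicator_const (hA S), one_mul]
    _ ≤ ∫⁻ _, ((n + 1) ^ (d + 3) : ℕ) ∂Measure.pi (fun _ : Fin n => P) := by
        refine lintegral_mono fun w => ?_
        simp only [Set.indicator_apply, Set.mem_ofPred_eq, Finset.sum_boole]
        refine Nat.cast_le.2 (le_trans (Finset.card_le_card fun S hS => ?_)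
          (card_nnFamily_le (k := k) K fun i => (w i).1))
        exact (Finset.mem_filter.1 hS).2
    _ = _ := by simp

/-- The stochastic part of the nearest-neighbour estimator has a measurable majorant with small
mean. -/
theorem exists_noise_majorant {d n k : ℕ}
    (P : Measure (EuclideanSpace ℝ (Fin d) × ℝ)) [IsProbabilityMeasure P]
    {K : Set (EuclideanSpace ℝ (Fin d))} (hK : IsCompact K)
    {f : EuclideanSpace ℝ (Fin d) → ℝ} (hf : Measurable f) {c₀ p : ℝ} (hc₀ : 0 < c₀) (hp : 0 < p)
    (hP : UniformNoise P f c₀) (hn : 2 ≤ n) (hk : 1 ≤ k) (hkn : k ≤ n) :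
    ∃ H : (Fin n → EuclideanSpace ℝ (Fin d) × ℝ) → ℝ≥0∞, Measurable H ∧
      (∀ w, ∀ x ∈ K,
        ENNReal.ofReal |(1 / (k : ℝ)) * ∑ i ∈ nnSet k (fun i => (w i).1) x,
          ((w i).2 - f (w i).1)| ^ p ≤ H w) ∧
      ∫⁻ w, H w ∂Measure.pi (fun _ => P) ≤ ENNReal.ofReal
        ((c₀ / √k) ^ p * ((4 * (d + 3) * Real.log n) ^ p + (2 * p) ^ p * (2 * Real.exp 1))) := by
  have hk0 : (0 : ℝ) < k := by exact_mod_cast hk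
  have hn0 : (0 : ℝ) < n := by exact_mod_cast (by omega : 0 < n)
  have hk1 : (1 : ℝ) ≤ √k := Real.one_le_sqrt.2 (by exact_mod_cast hk)
  have hlog : 0 ≤ Real.log n := Real.log_natCast_nonneg n
  set s : ℝ := 1 / (c₀ * √k) with hs
  set l : ℝ := 4 * (d + 3) * Real.log n with hl
  have hspos : 0 < s := by positivity
  have hs1 : |s| ≤ 1 / c₀ := by
    rw [abs_of_pos hspos]
    exact one_div_le_one_div_of_le hc₀ (le_mul_of_one_le_right hc₀.le hk1)
  let A : Finset (Fin n) → Set (Fin n → EuclideanSpace ℝ (Fin d) × ℝ) := fun S =>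
    {w | S ∈ nnFamily K k fun i => (w i).1}
  have hA : ∀ S, MeasurableSet (A S) := fun S => measurableSet_mem_nnFamily hK k S
  let E : ℝ → Finset (Fin n) → (Fin n → EuclideanSpace ℝ (Fin d) × ℝ) → ℝ≥0∞ := fun t S w =>
    (A S).indicator (fun _ => 1) w *
      ∏ i ∈ S, ENNReal.ofReal (Real.exp (t * ((w i).2 - f (w i).1)))
  have hE : ∀ t S, Measurable (E t S) := fun t S =>
    (measurable_const.indicator (hA S)).mul (Finset.measurable_prod _ fun i _ => by fun_prop)
  have hEexp : ∀ t S w, w ∈ A S →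
      E t S w = ENNReal.ofReal (Real.exp (t * ∑ i ∈ S, ((w i).2 - f (w i).1))) := by
    intro t S w hw
    simp only [E]
    rw [Set.indicator_of_mem hw, one_mul,
      ← ENNReal.ofReal_prod_of_nonneg fun i _ => (Real.exp_pos _).le, ← Real.exp_sum,
      Finset.mul_sum]
  have hEint : ∀ t S, |t| = s → S.card = k →
      ∫⁻ w, E t S w ∂Measure.pi (fun _ => P) ≤
        ENNReal.ofReal (Real.exp 1) * Measure.pi (fun _ => P) (A S) := by
    intro t S ht hS
    refine (lintegral_nnFamily_mul_exp_le P hK hf hP (by rwa [ht, ← abs_of_pos hspos]) S).trans_eq ?_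
    have h1 : t ^ 2 = s ^ 2 := by rw [← sq_abs, ht]
    rw [hS, ← ENNReal.ofReal_pow (Real.exp_pos _).le, ← Real.exp_nat_mul, h1, hs]
    have h2 : (k : ℝ) * (c₀ ^ 2 * (1 / (c₀ * √k)) ^ 2) = 1 := by
      rw [div_pow, mul_pow, Real.sq_sqrt hk0.le]
      field_simp
    rw [h2]
  have hsum : Measurable fun w => ∑ S ∈ Finset.univ.powersetCard k, (E s S w + E (-s) S w) :=
    Finset.measurable_sum _ fun S _ => (hE s S).add (hE (-s) S)
  refine ⟨fun w => ENNReal.ofReal ((c₀ / √k) ^ p * l ^ p) +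
    ENNReal.ofReal ((c₀ / √k) ^ p * ((2 * p) ^ p * Real.exp (-(l / 2)))) *
      ∑ S ∈ Finset.univ.powersetCard k, (E s S w + E (-s) S w),
      (hsum.const_mul _).const_add _, ?_, ?_⟩
  · intro w x hx
    set S := nnSet k (fun i => (w i).1) x with hSdef
    have hwS : w ∈ A S := mem_nnFamily (X := fun i => (w i).1).2 ⟨x, hx, rfl⟩
    have hScard : S ∈ (Finset.univ : Finset (Fin n)).powersetCard k :=
      Finset.mem_powersetCard.2 ⟨Finset.subset_univ _, card_nnSet hkn _ _⟩
    set T : ℝ := ∑ i ∈ S, ((w i).2 - f (w i).1) with hT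
    have h1 : |1 / (k : ℝ) * T| = c₀ / √k * (s * |T|) := by
      rw [abs_mul, abs_of_pos (by positivity), hs]
      field_simp
      rw [Real.sq_sqrt hk0.le, mul_comm]
    have h2 : Real.exp (s * |T|) ≤ Real.exp (s * T) + Real.exp (-s * T) := by
      rcases abs_cases T with h | h
      · rw [h.1]; linarith [Real.exp_pos (-s * T)]
      · rw [h.1, mul_neg, ← neg_mul]; linarith [Real.exp_pos (s * T)]
    have h3 := rpow_le_rpow_add_exp (l := l) hp (mul_nonneg hspos.le (abs_nonneg T))
      (by positivity)
    have h4 : |1 / (k : ℝ) * T| ^ p ≤ (c₀ / √k) ^ p * l ^ p +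
        (c₀ / √k) ^ p * ((2 * p) ^ p * Real.exp (-(l / 2))) *
          (Real.exp (s * T) + Real.exp (-s * T)) := by
      rw [h1, Real.mul_rpow (by positivity) (by positivity), mul_assoc _ _ (_ + _), ← mul_add]
      gcongr
      refine h3.trans ?_
      gcongr
    rw [ENNReal.ofReal_rpow_of_nonneg (abs_nonneg _) hp.le]
    refine (ENNReal.ofReal_le_ofReal h4).trans ?_
    rw [ENNReal.ofReal_add (by positivity) (by positivity),
      ENNReal.ofReal_mul (q := Real.exp (s * T) + Real.exp (-s * T)) (by positivity),
      ENNReal.ofReal_add (Real.exp_pos _).le (Real.exp_pos _).le,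
      ← hEexp s S w hwS, ← hEexp (-s) S w hwS]
    beta_reduce
    gcongr
    exact Finset.single_le_sum (f := fun S => E s S w + E (-s) S w) (fun _ _ => zero_le) hScard
  · have hint : ∫⁻ w, ∑ S ∈ Finset.univ.powersetCard k, (E s S w + E (-s) S w)
        ∂Measure.pi (fun _ => P) ≤ ENNReal.ofReal (2 * Real.exp 1 * (n + 1) ^ (d + 3)) := by
      calc ∫⁻ w, ∑ S ∈ Finset.univ.powersetCard k, (E s S w + E (-s) S w)
            ∂Measure.pi (fun _ => P)
          = ∑ S ∈ Finset.univ.powersetCard k, (∫⁻ w, E s S w ∂Measure.pi (fun _ => P) +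
              ∫⁻ w, E (-s) S w ∂Measure.pi (fun _ => P)) := by
            have hEE : ∀ S, Measurable fun w => E s S w + E (-s) S w := fun S =>
              (hE s S).add (hE (-s) S)
            rw [lintegral_finsetSum _ fun S _ => hEE S]
            exact Finset.sum_congr rfl fun S _ => lintegral_add_left (hE s S) _
        _ ≤ ∑ S ∈ Finset.univ.powersetCard k, ENNReal.ofReal (2 * Real.exp 1) *
              Measure.pi (fun _ => P) (A S) := by
            refine Finset.sum_le_sum fun S hS => ?_
            have hc := (Finset.mem_powersetCard.1 hS).2
            rw [two_mul, ENNReal.ofReal_add (Real.exp_pos _).le (Real.exp_pos _).le, add_mul]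
            exact add_le_add (hEint s S (abs_of_pos hspos) hc)
              (hEint (-s) S (by rw [abs_neg, abs_of_pos hspos]) hc)
        _ ≤ ENNReal.ofReal (2 * Real.exp 1) * ((n + 1) ^ (d + 3) : ℕ) := by
            rw [← Finset.mul_sum]
            gcongr
            exact sum_measure_mem_nnFamily_le P hK _
        _ = _ := by
            rw [← ENNReal.ofReal_natCast, ← ENNReal.ofReal_mul (by positivity)]
            push_cast
            rfl
    have hexp : Real.exp (-(l / 2)) * (n + 1) ^ (d + 3) ≤ 1 := by
      have h1 : Real.exp (l / 2) = ((n : ℝ) ^ 2) ^ (d + 3) := by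
        have : l / 2 = ((2 * (d + 3) : ℕ) : ℝ) * Real.log n := by rw [hl]; push_cast; ring
        rw [this, Real.exp_nat_mul, Real.exp_log hn0, pow_mul]
      have h2 : (n : ℝ) + 1 ≤ n ^ 2 := by
        have : (2 : ℝ) ≤ n := by exact_mod_cast hn
        nlinarith
      rw [Real.exp_neg, h1, inv_mul_le_one₀ (by positivity)]
      gcongr
    rw [lintegral_add_left measurable_const, lintegral_const, measure_univ, mul_one,
      lintegral_const_mul _ hsum, mul_add, ENNReal.ofReal_add (by positivity) (by positivity)]
    gcongr
    refine (mul_le_mul_right hint _).trans ?_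
    rw [← ENNReal.ofReal_mul (by positivity)]
    refine ENNReal.ofReal_le_ofReal ?_
    calc (c₀ / √k) ^ p * ((2 * p) ^ p * Real.exp (-(l / 2))) *
          (2 * Real.exp 1 * (n + 1) ^ (d + 3))
        = (c₀ / √k) ^ p * ((2 * p) ^ p * (2 * Real.exp 1)) *
          (Real.exp (-(l / 2)) * (n + 1) ^ (d + 3)) := by ring
      _ ≤ (c₀ / √k) ^ p * ((2 * p) ^ p * (2 * Real.exp 1)) * 1 := by gcongr
      _ = _ := mul_one _

theorem knnSupError_congr {d n k : ℕ} {K : Set (EuclideanSpace ℝ (Fin d))}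
    {f g : EuclideanSpace ℝ (Fin d) → ℝ} (h : Set.EqOn f g K)
    (X : Fin n → EuclideanSpace ℝ (Fin d)) (Y : Fin n → ℝ) :
    knnSupError K f k X Y = knnSupError K g k X Y :=
  iSup_congr fun x => iSup_congr fun hx => by rw [h hx]

theorem UniformNoise.congr {d : ℕ} {P : Measure (EuclideanSpace ℝ (Fin d) × ℝ)}
    {f g : EuclideanSpace ℝ (Fin d) → ℝ} {c₀ : ℝ} (hP : UniformNoise P f c₀)
    (h : ∀ᵐ z ∂P, f z.1 = g z.1) : UniformNoise P g c₀ := by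
  intro t ht
  have he : (fun z : EuclideanSpace ℝ (Fin d) × ℝ => Real.exp (t * (z.2 - f z.1))) =ᵐ[P]
      fun z => Real.exp (t * (z.2 - g z.1)) := by
    filter_upwards [h] with z hz
    rw [hz]
  exact ⟨(hP t ht).1.congr he, (condExp_congr_ae he).symm.trans_le (hP t ht).2⟩

theorem lintegral_knnSupError_rpow_le {d n k : ℕ} (hd : 1 ≤ d)
    (P : Measure (EuclideanSpace ℝ (Fin d) × ℝ)) [IsProbabilityMeasure P]
    {K : Set (EuclideanSpace ℝ (Fin d))} (hK : IsCompact K)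
    {f : EuclideanSpace ℝ (Fin d) → ℝ} {L : NNReal} (hf : LipschitzWith L f)
    {κ r₀ D p c₀ : ℝ} (hκ : 0 < κ) (hr₀ : 0 < r₀) (hD : 0 ≤ D) (hp : 1 ≤ p) (hc₀ : 0 < c₀)
    (hPK : ∀ᵐ z ∂P, z.1 ∈ K)
    (hmass : ∀ x ∈ K, ∀ r, 0 < r → r ≤ r₀ →
      ENNReal.ofReal (κ * r ^ d) ≤ P.fst (Metric.closedBall x r))
    (hdiam : ∀ x ∈ K, ∀ y ∈ K, dist x y ≤ D) (hP : UniformNoise P f c₀)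
    (hn : 2 ≤ n) (hk : 1 ≤ k) (hkn : k ≤ n) :
    ∫⁻ w, knnSupError K f k (fun i => (w i).1) (fun i => (w i).2) ^ p
        ∂Measure.pi (fun _ : Fin n => P) ≤
      ENNReal.ofReal (2 ^ (p - 1) *
        (((2 * L + L * D / r₀) * (4 * k / (κ * n)) ^ (1 / (d : ℝ))) ^ p +
          (L * D) ^ p * (2 ^ d * (n * Real.exp (-k))) +
        (c₀ / √k) ^ p * ((4 * (d + 3) * Real.log n) ^ p + (2 * p) ^ p * (2 * Real.exp 1)))) := by
  have hp0 : 0 < p := by linarith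
  obtain ⟨H₁, hH₁m, hH₁, hH₁int⟩ := exists_bias_majorant hd P hf hκ hr₀ hD hp0 hmass hdiam hk hkn
  obtain ⟨H₂, hH₂m, hH₂, hH₂int⟩ := exists_noise_majorant P hK hf.continuous.measurable hc₀ hp0 hP
    hn hk hkn
  have hae : ∀ᵐ w ∂Measure.pi (fun _ : Fin n => P), ∀ i, (w i).1 ∈ K :=
    Filter.eventually_all.2 fun i =>
      (measurePreserving_eval (fun _ : Fin n => P) i).quasiMeasurePreserving.ae hPK
  have hpt : ∀ w : Fin n → EuclideanSpace ℝ (Fin d) × ℝ, (∀ i, (w i).1 ∈ K) →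
      knnSupError K f k (fun i => (w i).1) (fun i => (w i).2) ^ p ≤
        ENNReal.ofReal (2 ^ (p - 1)) * (H₁ w + H₂ w) := by
    intro w hw
    rw [← ENNReal.le_rpow_inv_iff hp0]
    refine iSup₂_le fun x hx => ?_
    rw [ENNReal.le_rpow_inv_iff hp0]
    have hk0 : (k : ℝ) ≠ 0 := by positivity
    have hdecomp : knnEstimator k (fun i => (w i).1) (fun i => (w i).2) x - f x =
        (1 / (k : ℝ)) * ∑ i ∈ nnSet k (fun i => (w i).1) x, (f (w i).1 - f x) +
        (1 / (k : ℝ)) * ∑ i ∈ nnSet k (fun i => (w i).1) x, ((w i).2 - f (w i).1) := by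
      rw [knnEstimator_eq_sum_nnSet, ← mul_add, ← Finset.sum_add_distrib]
      simp only [add_comm, sub_add_sub_cancel]
      rw [Finset.sum_sub_distrib, Finset.sum_const, card_nnSet hkn, nsmul_eq_mul]
      field_simp
    calc ENNReal.ofReal |knnEstimator k (fun i => (w i).1) (fun i => (w i).2) x - f x| ^ p
        ≤ (ENNReal.ofReal |(1 / (k : ℝ)) *
              ∑ i ∈ nnSet k (fun i => (w i).1) x, (f (w i).1 - f x)| +
            ENNReal.ofReal |(1 / (k : ℝ)) *
              ∑ i ∈ nnSet k (fun i => (w i).1) x, ((w i).2 - f (w i).1)|) ^ p := by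
          rw [hdecomp, ← ENNReal.ofReal_add (abs_nonneg _) (abs_nonneg _)]
          gcongr
          exact abs_add_le _ _
      _ ≤ 2 ^ (p - 1) * (ENNReal.ofReal |(1 / (k : ℝ)) *
              ∑ i ∈ nnSet k (fun i => (w i).1) x, (f (w i).1 - f x)| ^ p +
            ENNReal.ofReal |(1 / (k : ℝ)) *
              ∑ i ∈ nnSet k (fun i => (w i).1) x, ((w i).2 - f (w i).1)| ^ p) :=
          ENNReal.rpow_add_le_mul_rpow_add_rpow _ _ hp
      _ ≤ ENNReal.ofReal (2 ^ (p - 1)) * (H₁ w + H₂ w) := by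
          rw [← ENNReal.ofReal_rpow_of_pos two_pos, ENNReal.ofReal_ofNat]
          gcongr
          · exact hH₁ w hw x hx
          · exact hH₂ w x hx
  have hlog : 0 ≤ Real.log n := Real.log_natCast_nonneg n
  have hL : (0 : ℝ) ≤ L := L.2
  calc ∫⁻ w, knnSupError K f k (fun i => (w i).1) (fun i => (w i).2) ^ p
        ∂Measure.pi (fun _ : Fin n => P)
      ≤ ∫⁻ w, ENNReal.ofReal (2 ^ (p - 1)) * (H₁ w + H₂ w) ∂Measure.pi (fun _ : Fin n => P) :=
        lintegral_mono_ae (hae.mono hpt)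
    _ = ENNReal.ofReal (2 ^ (p - 1)) * (∫⁻ w, H₁ w ∂Measure.pi (fun _ : Fin n => P) +
          ∫⁻ w, H₂ w ∂Measure.pi (fun _ : Fin n => P)) := by
        have hadd : Measurable fun w => H₁ w + H₂ w := hH₁m.add hH₂m
        rw [lintegral_const_mul _ hadd, lintegral_add_left hH₁m]
    _ ≤ _ := by
        rw [ENNReal.ofReal_mul (by positivity), ENNReal.ofReal_add (by positivity) (by positivity)]
        gcongr

/-- The choice `k ≍ n ^ (2 / (d + 2))` balances the bias and the stochastic error. -/
theorem exists_rate_const {d : ℕ} (hd : 1 ≤ d) {B κ p c₀ a b M : ℝ} (hB : 0 ≤ B) (hκ : 0 < κ)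
    (hp : 1 ≤ p) (hc₀ : 0 < c₀) (ha : 0 < a) (hab : a ≤ b) (hM : 0 ≤ M) :
    ∃ C : ℝ, 0 < C ∧ ∀ n k : ℕ, 2 ≤ n → 1 ≤ k →
      a * (n : ℝ) ^ (2 / ((d : ℝ) + 2)) ≤ k → (k : ℝ) ≤ b * (n : ℝ) ^ (2 / ((d : ℝ) + 2)) →
      2 ^ (p - 1) * ((B * (4 * k / (κ * n)) ^ (1 / (d : ℝ))) ^ p +
          M ^ p * (2 ^ d * (n * Real.exp (-k))) +
        (c₀ / √k) ^ p * ((4 * (d + 3) * Real.log n) ^ p + (2 * p) ^ p * (2 * Real.exp 1))) ≤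
      C * Real.log n ^ p * (n : ℝ) ^ (-p / ((d : ℝ) + 2)) := by
  have hp0 : 0 < p := by linarith
  have hb : 0 < b := ha.trans_le hab
  have hd0 : (0 : ℝ) < d := by exact_mod_cast hd
  have hl2 : 0 < Real.log 2 := Real.log_pos one_lt_two
  set q : ℝ := (d + 2 + p) / 2 with hq
  have hq0 : 0 < q := by positivity
  set C₁ : ℝ := (B * (4 * b / κ) ^ (1 / (d : ℝ))) ^ p
  set C₂ : ℝ := M ^ p * (2 ^ d * (q ^ q / a ^ q))
  set C₃ : ℝ := (c₀ / √a) ^ p * ((2 * p) ^ p * (2 * Real.exp 1))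
  set C₄ : ℝ := (c₀ / √a) ^ p * (4 * (d + 3)) ^ p
  have hC₁ : 0 ≤ C₁ := by positivity
  have hC₂ : 0 ≤ C₂ := by positivity
  have hC₃ : 0 ≤ C₃ := by positivity
  have hC₄ : 0 < C₄ := by positivity
  refine ⟨2 ^ (p - 1) * ((C₁ + C₂ + C₃) / Real.log 2 ^ p + C₄), by positivity, ?_⟩
  intro n k hn hk hak hkb
  have hn0 : (0 : ℝ) < n := by positivity
  have hk0 : (0 : ℝ) < k := by exact_mod_cast hk
  have hlogn : Real.log 2 ≤ Real.log n := Real.log_le_log two_pos (by exact_mod_cast hn)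
  have hlog0 : 0 < Real.log n := hl2.trans_le hlogn
  have hd2 : (0 : ℝ) < d + 2 := by positivity
  have h1 : (B * (4 * k / (κ * n)) ^ (1 / (d : ℝ))) ^ p ≤
      C₁ * (n : ℝ) ^ (-p / ((d : ℝ) + 2)) := by
    have hr : (4 * k / (κ * n)) ^ (1 / (d : ℝ)) ≤
        (4 * b / κ) ^ (1 / (d : ℝ)) * (n : ℝ) ^ (-1 / ((d : ℝ) + 2)) := by
      have he : (n : ℝ) ^ (-1 / ((d : ℝ) + 2)) =
          ((n : ℝ) ^ (2 / ((d : ℝ) + 2)) / n) ^ (1 / (d : ℝ)) := by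
        nth_rw 3 [← Real.rpow_one (n : ℝ)]
        rw [← Real.rpow_sub hn0, ← Real.rpow_mul hn0.le]
        congr 1
        field_simp
        ring
      rw [he, ← Real.mul_rpow (by positivity) (by positivity)]
      refine Real.rpow_le_rpow (by positivity) ?_ (by positivity)
      rw [div_mul_div_comm]
      gcongr ?_ / _
      linarith
    calc (B * (4 * k / (κ * n)) ^ (1 / (d : ℝ))) ^ p
        ≤ (B * ((4 * b / κ) ^ (1 / (d : ℝ)) * (n : ℝ) ^ (-1 / ((d : ℝ) + 2)))) ^ p := by gcongr
      _ = C₁ * (n : ℝ) ^ (-p / ((d : ℝ) + 2)) := by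
        rw [← mul_assoc, Real.mul_rpow (by positivity) (by positivity), ← Real.rpow_mul hn0.le]
        congr 2
        ring
  have h2 : M ^ p * (2 ^ d * (n * Real.exp (-k))) ≤ C₂ * (n : ℝ) ^ (-p / ((d : ℝ) + 2)) := by
    have hnq : (n : ℝ) = ((n : ℝ) ^ (2 / ((d : ℝ) + 2))) ^ q * (n : ℝ) ^ (-p / ((d : ℝ) + 2)) := by
      rw [← Real.rpow_mul hn0.le, ← Real.rpow_add hn0]
      nth_rw 1 [← Real.rpow_one (n : ℝ)]
      congr 1
      rw [hq]
      field_simp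
      ring
    have hkq : ((n : ℝ) ^ (2 / ((d : ℝ) + 2))) ^ q ≤ q ^ q / a ^ q * Real.exp k := by
      have h3 : (n : ℝ) ^ (2 / ((d : ℝ) + 2)) ≤ k / a := by
        rw [le_div_iff₀ ha]; linarith
      have h4 := rpow_le_mul_exp hq0 one_pos hk0.le
      rw [div_one, one_mul] at h4
      calc ((n : ℝ) ^ (2 / ((d : ℝ) + 2))) ^ q ≤ (k / a) ^ q := by gcongr
        _ = k ^ q / a ^ q := Real.div_rpow hk0.le ha.le q
        _ ≤ q ^ q * Real.exp k / a ^ q := by gcongr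
        _ = _ := by ring
    have h5 : n * Real.exp (-k) ≤ q ^ q / a ^ q * (n : ℝ) ^ (-p / ((d : ℝ) + 2)) := by
      calc n * Real.exp (-k)
          = ((n : ℝ) ^ (2 / ((d : ℝ) + 2))) ^ q * (n : ℝ) ^ (-p / ((d : ℝ) + 2)) *
            Real.exp (-k) := by rw [← hnq]
        _ ≤ q ^ q / a ^ q * Real.exp k * (n : ℝ) ^ (-p / ((d : ℝ) + 2)) * Real.exp (-k) := by
          gcongr
        _ = q ^ q / a ^ q * (n : ℝ) ^ (-p / ((d : ℝ) + 2)) * (Real.exp k * Real.exp (-k)) := by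
          ring
        _ = _ := by rw [← Real.exp_add]; simp
    calc M ^ p * (2 ^ d * (n * Real.exp (-k)))
        ≤ M ^ p * (2 ^ d * (q ^ q / a ^ q * (n : ℝ) ^ (-p / ((d : ℝ) + 2)))) := by gcongr
      _ = _ := by simp only [C₂]; ring
  have h3 : (c₀ / √k) ^ p ≤ (c₀ / √a) ^ p * (n : ℝ) ^ (-p / ((d : ℝ) + 2)) := by
    have hs : √a * (n : ℝ) ^ (1 / ((d : ℝ) + 2)) ≤ √k := by
      refine Real.le_sqrt_of_sq_le ?_
      rw [mul_pow, Real.sq_sqrt ha.le, ← Real.rpow_natCast, ← Real.rpow_mul hn0.le]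
      refine le_trans (le_of_eq ?_) hak
      congr 2
      push_cast
      ring
    calc (c₀ / √k) ^ p ≤ (c₀ / (√a * (n : ℝ) ^ (1 / ((d : ℝ) + 2)))) ^ p := by gcongr
      _ = (c₀ / √a * (n : ℝ) ^ (-1 / ((d : ℝ) + 2))) ^ p := by
        rw [neg_div, Real.rpow_neg hn0.le]
        congr 1
        field_simp
      _ = _ := by
        rw [Real.mul_rpow (by positivity) (by positivity), ← Real.rpow_mul hn0.le]
        congr 2
        ring
  have h4 : 1 ≤ Real.log n ^ p / Real.log 2 ^ p := by
    rw [one_le_div (by positivity)]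
    gcongr
  set ν : ℝ := (n : ℝ) ^ (-p / ((d : ℝ) + 2))
  have hν : 0 ≤ ν := by positivity
  calc 2 ^ (p - 1) * ((B * (4 * k / (κ * n)) ^ (1 / (d : ℝ))) ^ p +
          M ^ p * (2 ^ d * (n * Real.exp (-k))) +
        (c₀ / √k) ^ p * ((4 * (d + 3) * Real.log n) ^ p + (2 * p) ^ p * (2 * Real.exp 1)))
      ≤ 2 ^ (p - 1) * (C₁ * ν + C₂ * ν + ((c₀ / √a) ^ p * ν) *
        ((4 * (d + 3) * Real.log n) ^ p + (2 * p) ^ p * (2 * Real.exp 1))) := by gcongr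
    _ = 2 ^ (p - 1) * ((C₁ + C₂ + C₃) * 1 + C₄ * Real.log n ^ p) * ν := by
        rw [Real.mul_rpow (by positivity) hlog0.le]
        simp only [C₃, C₄]
        ring
    _ ≤ 2 ^ (p - 1) * ((C₁ + C₂ + C₃) * (Real.log n ^ p / Real.log 2 ^ p) +
          C₄ * Real.log n ^ p) * ν := by gcongr
    _ = _ := by ring

theorem mainTheorem7 {d : ℕ} (hd : 1 ≤ d)
    (K : Set (EuclideanSpace ℝ (Fin d))) (hK : IsCompact K) (hKreg : IsRegularSet K)
    (f : EuclideanSpace ℝ (Fin d) → ℝ) (hf : ∃ L, LipschitzOnWith L f K)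
    (c₀ μmin : ℝ) (hc₀ : 0 < c₀) (hμmin : 0 < μmin)
    (p : ℝ) (hp : 1 ≤ p) (a b : ℝ) (ha : 0 < a) (hab : a ≤ b) :
    ∃ C : ℝ, 0 < C ∧
      ∀ (P : Measure (EuclideanSpace ℝ (Fin d) × ℝ)) [IsProbabilityMeasure P] (μmax : ℝ),
        StrongDensity P.fst K μmin μmax →
        IsRegressionFunction P f →
        UniformNoise P f c₀ →
        ∀ (Ω : Type*) [MeasurableSpace Ω] (ρ : Measure Ω) [IsProbabilityMeasure ρ]
          (n : ℕ) (X : Fin n → Ω → EuclideanSpace ℝ (Fin d)) (Y : Fin n → Ω → ℝ),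
          2 ≤ n →
          (∀ i, HasLaw (fun ω => (X i ω, Y i ω)) P ρ) →
          iIndepFun (fun i ω => (X i ω, Y i ω)) ρ →
          ∀ k : ℕ, k ≤ n →
            a * (n : ℝ) ^ (2 / ((d : ℝ) + 2)) ≤ k →
            (k : ℝ) ≤ b * (n : ℝ) ^ (2 / ((d : ℝ) + 2)) →
            AEMeasurable
                (fun ω => knnSupError K f k (fun i => X i ω) (fun i => Y i ω)) ρ ∧
              ∫⁻ ω, knnSupError K f k (fun i => X i ω) (fun i => Y i ω) ^ p ∂ρ ≤
                ENNReal.ofReal (C * Real.log n ^ p * (n : ℝ) ^ (-p / ((d : ℝ) + 2))) := by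
  obtain ⟨L, hL⟩ := hf
  obtain ⟨g, hg, hfg⟩ := hL.extend_real
  obtain ⟨hKm, c, r₀, hc, hr₀, hreg⟩ := hKreg
  set V : ℝ := volume.real (Metric.ball (0 : EuclideanSpace ℝ (Fin d)) 1)
  have hV : 0 < V := ENNReal.toReal_pos (Metric.measure_ball_pos _ _ one_pos).ne'
    measure_ball_lt_top.ne
  set κ : ℝ := μmin * c * V
  have hκ : 0 < κ := by positivity
  set D : ℝ := Metric.diam K
  have hD : 0 ≤ D := Metric.diam_nonneg
  have hL0 : (0 : ℝ) ≤ L := L.2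
  obtain ⟨C, hC, hrate⟩ := exists_rate_const (B := 2 * L + L * D / r₀) (M := L * D) hd
    (by positivity) hκ hp hc₀ ha hab (by positivity)
  refine ⟨C, hC, ?_⟩
  intro P _ μmax hdens _ hnoise Ω _ ρ _ n X Y hn hlaw hindep k hkn hak hkb
  have hn0 : (0 : ℝ) < n := by positivity
  have hk : 1 ≤ k := by
    have : (0 : ℝ) < k := lt_of_lt_of_le (by positivity) hak
    exact_mod_cast this
  have hPK : ∀ᵐ z ∂P, z.1 ∈ K := ae_of_ae_map measurable_fst.aemeasurable hdens.1
  have hnoise' : UniformNoise P g c₀ := hnoise.congr (hPK.mono fun z hz => hfg hz)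
  have hW : HasLaw (fun ω i => (X i ω, Y i ω)) (Measure.pi fun _ : Fin n => P) ρ :=
    iIndepFun.hasLaw_pi hlaw hindep
  have hmeas : Measurable fun w : Fin n → EuclideanSpace ℝ (Fin d) × ℝ =>
      knnSupError K g k (fun i => (w i).1) (fun i => (w i).2) :=
    measurable_knnSupError hK hg.continuous.continuousOn k
  have hcomp : AEMeasurable
      (fun ω => knnSupError K g k (fun i => X i ω) (fun i => Y i ω)) ρ := by
    have h := hmeas.comp_aemeasurable hW.aemeasurable
    exact h
  simp only [knnSupError_congr hfg]
  refine ⟨hcomp, ?_⟩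
  calc ∫⁻ ω, knnSupError K g k (fun i => X i ω) (fun i => Y i ω) ^ p ∂ρ
      = ∫⁻ w, knnSupError K g k (fun i => (w i).1) (fun i => (w i).2) ^ p
          ∂Measure.pi (fun _ : Fin n => P) := by
        rw [← hW.map_eq, lintegral_map' (hmeas.pow_const p).aemeasurable hW.aemeasurable]
    _ ≤ _ := lintegral_knnSupError_rpow_le hd P hK hg hκ hr₀ hD hp hc₀ hPK
        (fun x hx r hr hrr => hdens.le_measure_closedBall hKm hμmin hc hr.le (hreg x hx r hr hrr))
        (fun x hx y hy => Metric.dist_le_diam_of_mem hK.isBounded hx hy) hnoise' hn hk hkn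
    _ ≤ _ := ENNReal.ofReal_le_ofReal (hrate n k hn hk hak hkb)
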